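/- Let $\psi:\mathbb R^d\to\mathbb R$ be convex, continuously differentiable and bounded below, let $B\in\mathbb R^{d\times m}$ and $D\in\mathbb R^{n\times m}$ with $D^\top D=I$, let $\lambda,\gamma>0$, $\alpha\in(0,1)$, $\rho'\in\bigl(0,\frac{\lambda}{\gamma}\frac{1-\alpha}{\alpha}\bigr)$, let $p,q>0$ with $pq>\|B\|_2^2$ (spectral norm), and let $e^1,e^2,\dots$ be positive reals with $\sum_{k\ge 0}e^{k+1}<\infty$. Let $\|u\|_0$ be the number of nonzero components of $u$, and put $$F(u,v)=\psi(Bv)+\tfrac{\lambda}{2\gamma}\|u-Dv\|_2^2+\lambda\|u\|_0,\qquad H(v;u)=\tfrac{\lambda}{2\gamma}\|v-D^\top u\|_2^2+\psi(Bv),$$ $$\mathcal S=\bigl(I+\tfrac{\gamma}{\lambda}\nabla(\psi\circ B)\bigr)^{-1},\qquad \operatorname{prox}_{tf}(y)=\operatorname{argmin}_x\bigl\{\tfrac1{2t}\|x-y\|_2^2+f(x)\bigr\}\ \text{(a set)}.$$ **Algorithm.** Start at arbitrary $u^0\in\mathbb R^n$, $v^0\in\mathbb R^m$, $w^0\in\mathbb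 R^d$. For $k=0,1,2,\dots$: 1. Choose $u^{k+1}\in\operatorname{prox}_{\alpha\gamma\|\cdot\|_0}\bigl((1-\alpha)u^k+\alpha Dv^k\bigr)$. 2. If $\|u^{k+1}-u^k\|_2^2+\|\nabla H(v^k;u^{k+1})\|_2^2=0$ (the gradient is taken in the first argument of $H$), put $v^{k+1}=v^k$, $w^{k+1}=w^k$. Otherwise put $v_1=v^k$, $w_1=w^k$, and for $l=1,2,\dots$ compute $$v_{l+1}=\tfrac{\lambda}{p\gamma+\lambda}D^\top u^{k+1}+\tfrac{p\gamma}{p\gamma+\lambda}\bigl(v_l-\tfrac1pB^\top w_l\bigr),$$ $$w_{l+1}=\tfrac1q\bigl(I-(I+q\nabla\psi)^{-1}\bigr)\bigl(qw_l+B(2v_{l+1}-v_l)\bigr),$$ until for the first time $$F(u^{k+1},v_{l+1})-F(u^{k+1},v^k)\le\tfrac{\rho'}2\|u^{k+1}-u^k\|_2^2\quad\text{and}\quad\|\nabla H(v_{l+1};u^{k+1})\|_2\le e^{k+1};$$ then put $v^{k+1}=v_{l+1}$, $w^{k+1}=w_{l+1}$. **Theorem.** (i) The algorithm is executable: for every $k$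 and all $(u^k,v^k,w^k)$ the set in step 1 is nonempty, and for every choice of $u^{k+1}$ in it step 2 terminates after finitely many inner iterations. (ii) Let $(u^k,v^k,w^k)_{k\ge0}$ be any sequence generated by the algorithm. There is a set $C\subseteq\{1,\dots,n\}$ with $\{i:u^k_i\ne0\}=C$ for all sufficiently large $k$. Let $\mathbf T_C$ be the diagonal matrix with diagonal entries $1$ at the indices in $C$ and $0$ elsewhere. If the operator $$\mathcal T(u)=(1-\alpha)\mathbf T_Cu+\alpha\mathbf T_CD\,\mathcal S(D^\top u),\qquad u\in\mathbb R^n,$$ has a fixed point, then $(u^k,v^k)$ converges to a local minimizer $(u^*,v^*)$ of $F$ on $\mathbb R^n\times\mathbb R^m$. -/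

import Mathlib

open Filter Topology
open scoped Matrix Matrix.Norms.L2Operator

noncomputable section

namespace InexactFPPA

/-- The Euclidean space `ℝᵏ`. -/
abbrev E (k : ℕ) : Type := EuclideanSpace ℝ (Fin k)

/-- The product of a matrix and a vector. -/
abbrev mulV {k l : ℕ} (A : Matrix (Fin k) (Fin l) ℝ) (x : E l) : E k :=
  Matrix.toEuclideanLin A x

/-- The number of nonzero components of a vector. -/
def l0norm {n : ℕ} (u : E n) : ℝ :=
  (hammingNorm (fun i : Fin n => u i) : ℝ)

/-- The set of indices of the nonzero components of a vector. -/
def supp {n : ℕ} (u : E n) : Finset (Fin n) :=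
  Finset.univ.filter fun i => u i ≠ 0

/-- The set-valued proximity operator of `t f`: all global minimizers of
`x ↦ ‖x - y‖² / (2 t) + f x`. -/
def prox {k : ℕ} (f : E k → ℝ) (t : ℝ) (y : E k) : Set (E k) :=
  {x | ∀ z : E k, 1 / (2 * t) * ‖x - y‖ ^ 2 + f x ≤ 1 / (2 * t) * ‖z - y‖ ^ 2 + f z}

/-- The inverse map `(I + t g)⁻¹`. -/
def resolvent {k : ℕ} (g : E k → E k) (t : ℝ) : E k → E k :=
  Function.invFun fun y => y + t • g y

/-- `F(u, v) = ψ(B v) + λ / (2 γ) ‖u - D v‖² + λ ‖u‖₀`. -/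
def F {n m d : ℕ} (ψ : E d → ℝ) (B : Matrix (Fin d) (Fin m) ℝ) (D : Matrix (Fin n) (Fin m) ℝ)
    (lam gam : ℝ) (u : E n) (v : E m) : ℝ :=
  ψ (mulV B v) + lam / (2 * gam) * ‖u - mulV D v‖ ^ 2 + lam * l0norm u

/-- `H(v; u) = λ / (2 γ) ‖v - Dᵀ u‖² + ψ(B v)`. -/
def H {n m d : ℕ} (ψ : E d → ℝ) (B : Matrix (Fin d) (Fin m) ℝ) (D : Matrix (Fin n) (Fin m) ℝ)
    (lam gam : ℝ) (v : E m) (u : E n) : ℝ :=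
  lam / (2 * gam) * ‖v - mulV Dᵀ u‖ ^ 2 + ψ (mulV B v)

/-- The gradient of `H(·; u)` at `v`. -/
def gradH {n m d : ℕ} (ψ : E d → ℝ) (B : Matrix (Fin d) (Fin m) ℝ)
    (D : Matrix (Fin n) (Fin m) ℝ) (lam gam : ℝ) (v : E m) (u : E n) : E m :=
  gradient (fun x => H ψ B D lam gam x u) v

/-- The operator `S = (I + (γ / λ) ∇(ψ ∘ B))⁻¹`. -/
def S {m d : ℕ} (ψ : E d → ℝ) (B : Matrix (Fin d) (Fin m) ℝ) (lam gam : ℝ) : E m → E m :=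
  resolvent (gradient fun v : E m => ψ (mulV B v)) (gam / lam)

/-- The diagonal zero-one matrix that keeps the components in `C`. -/
def diagMask {n : ℕ} (C : Finset (Fin n)) : Matrix (Fin n) (Fin n) ℝ :=
  Matrix.diagonal fun i => if i ∈ C then 1 else 0

/-- The operator `T(u) = (1 - α) T_C u + α T_C D S(Dᵀ u)`. -/
def T {n m d : ℕ} (ψ : E d → ℝ) (B : Matrix (Fin d) (Fin m) ℝ) (D : Matrix (Fin n) (Fin m) ℝ)
    (lam gam α : ℝ) (C : Finset (Fin n)) (u : E n) : E n :=
  (1 - α) • mulV (diagMask C) u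
    + α • mulV (diagMask C) (mulV D (S ψ B lam gam (mulV Dᵀ u)))

/-- One pass of the inner loop, acting on the pair `(v_l, w_l)`; `u` is the current outer
iterate. -/
def innerStep {n m d : ℕ} (ψ : E d → ℝ) (B : Matrix (Fin d) (Fin m) ℝ)
    (D : Matrix (Fin n) (Fin m) ℝ) (lam gam p q : ℝ) (u : E n) (s : E m × E d) : E m × E d :=
  let v : E m := (lam / (p * gam + lam)) • mulV Dᵀ u
    + (p * gam / (p * gam + lam)) • (s.1 - (1 / p) • mulV Bᵀ s.2)
  let z : E d := q • s.2 + mulV B ((2 : ℝ) • v - s.1)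
  (v, (1 / q) • (z - resolvent (gradient ψ) q z))

/-- The condition under which the inner loop is continued: `u`, `v` are the old outer iterates,
`uNew` is the new one, `x` is the current inner iterate and `ε` is the prescribed accuracy. -/
def Continues {n m d : ℕ} (ψ : E d → ℝ) (B : Matrix (Fin d) (Fin m) ℝ)
    (D : Matrix (Fin n) (Fin m) ℝ) (lam gam ρ ε : ℝ) (u uNew : E n) (v x : E m) : Prop :=
  F ψ B D lam gam uNew x - F ψ B D lam gam uNew v > ρ / 2 * ‖uNew - u‖ ^ 2 ∨
    ‖gradH ψ B D lam gam x uNew‖ > ε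

/-- `(vNew, wNew)` is what the algorithm computes from the old iterates `u`, `v`, `w` and the
new iterate `uNew`. If the test quantity is positive, a do-while loop started at `(v, w)` is
run: `L ≥ 1` passes are made, the loop being continued after each pass before the last one
and left after the last one. Otherwise nothing is changed. -/
def InnerResult {n m d : ℕ} (ψ : E d → ℝ) (B : Matrix (Fin d) (Fin m) ℝ)
    (D : Matrix (Fin n) (Fin m) ℝ) (lam gam ρ p q ε : ℝ) (u uNew : E n)
    (v : E m) (w : E d) (vNew : E m) (wNew : E d) : Prop :=
  (‖uNew - u‖ ^ 2 + ‖gradH ψ B D lam gam v uNew‖ ^ 2 > 0 →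
    ∃ L : ℕ, 1 ≤ L ∧
      (∀ l : ℕ, 1 ≤ l → l < L → Continues ψ B D lam gam ρ ε u uNew v
        ((innerStep ψ B D lam gam p q uNew)^[l] (v, w)).1) ∧
      ¬ Continues ψ B D lam gam ρ ε u uNew v
        ((innerStep ψ B D lam gam p q uNew)^[L] (v, w)).1 ∧
      (vNew, wNew) = (innerStep ψ B D lam gam p q uNew)^[L] (v, w)) ∧
  (¬ (‖uNew - u‖ ^ 2 + ‖gradH ψ B D lam gam v uNew‖ ^ 2 > 0) → vNew = v ∧ wNew = w)

/-- The set in which the new iterate `u` is chosen, given the old iterates `u` and `v`. -/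
def uCandidates {n m : ℕ} (D : Matrix (Fin n) (Fin m) ℝ) (gam α : ℝ) (u : E n) (v : E m) :
    Set (E n) :=
  prox l0norm (α * gam) ((1 - α) • u + α • mulV D v)

/-- `(u k, v k, w k)`, `k = 0, 1, 2, …`, are the outer iterates of a run of the inexact
fixed-point proximity algorithm; the run is started at the arbitrary point `(u 0, v 0, w 0)`
and the accuracy `e (k + 1)` is prescribed in the computation of the iterates number `k + 1`. -/
def IsRun {n m d : ℕ} (ψ : E d → ℝ) (B : Matrix (Fin d) (Fin m) ℝ)
    (D : Matrix (Fin n) (Fin m) ℝ) (lam gam α ρ p q : ℝ) (e : ℕ → ℝ)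
    (u : ℕ → E n) (v : ℕ → E m) (w : ℕ → E d) : Prop :=
  ∀ k : ℕ, u (k + 1) ∈ uCandidates D gam α (u k) (v k) ∧
    InnerResult ψ B D lam gam ρ p q (e (k + 1)) (u k) (u (k + 1))
      (v k) (w k) (v (k + 1)) (w (k + 1))

end InexactFPPA

end

/-! Outer loop. Comparing `u (k + 1)` with `u k` in the prox problem shows that step 1 lowers `F` by
at least `lam * (1 - α) / (2 * α * gam) * ‖u (k + 1) - u k‖ ^ 2`; the inner loop gives back at most
`ρ / 2 * ‖u (k + 1) - u k‖ ^ 2`, which is strictly less unless the increment vanishes. Since `F` is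
bounded below, the increments tend to zero. Nonzero entries produced by hard thresholding have
modulus at least `√(2αγ)`, so the support must freeze at some `C`.

From then on step 1 is linear, and the gradient test keeps `v k` within `gam / lam * e k` of `S (Dᵀ
u k)`. Thus `u` is an orbit of the nonexpansive map `T` up to summable errors. Given a fixed point,
distances to fixed points converge and, as the increments vanish, cluster points are fixed, so the
whole orbit converges (`exists_tendsto_fixedPoint`). The limit is stationary on its own support. It
is a local minimizer: nearby supports can only grow, and growth costs `lam`, while on the same
support the problem is convex (`isLocalMin_F`).

Inner loop. It is a primal-dual iteration whose energy relative to the saddle point is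
nonincreasing; strong convexity of `H` adds a summable surplus that forces the primal part to `S (Dᵀ
u)`. There the gradient vanishes and the value test holds strictly, so the loop stops. -/

namespace InexactFPPA

/-! ### Convex functions and monotone gradients. -/

section Convex

variable {V : Type*} [NormedAddCommGroup V] [InnerProductSpace ℝ V]

theorem norm_sub_le_of_monotone {g : V → V}
    (hg : ∀ x y, 0 ≤ inner ℝ (g x - g y) (x - y)) {t : ℝ} (ht : 0 ≤ t) (x y : V) :
    ‖x - y‖ ≤ ‖(x + t • g x) - (y + t • g y)‖ := by
  have h1 : (x + t • g x) - (y + t • g y) = (x - y) + t • (g x - g y) := by module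
  have h2 : ‖x - y‖ * ‖x - y‖ ≤ ‖(x + t • g x) - (y + t • g y)‖ * ‖x - y‖ := by
    refine le_trans ?_ (real_inner_le_norm _ _)
    rw [h1, inner_add_left, real_inner_smul_left, real_inner_self_eq_norm_mul_norm]
    nlinarith [hg x y]
  rcases (norm_nonneg (x - y)).eq_or_lt with h | h
  · rw [← h]; positivity
  · exact le_of_mul_le_mul_right h2 h

variable [CompleteSpace V] {φ : V → ℝ}

theorem add_inner_le_of_convexOn (hφ : ConvexOn ℝ Set.univ φ) {x g : V}
    (hg : HasGradientAt φ g x) (y : V) : φ x + inner ℝ g (y - x) ≤ φ y := by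
  have hc : ConvexOn ℝ Set.univ (φ ∘ AffineMap.lineMap (k := ℝ) x y) := by
    simpa using hφ.comp_affineMap (AffineMap.lineMap (k := ℝ) x y)
  have hd : HasDerivAt (φ ∘ AffineMap.lineMap (k := ℝ) x y) (inner ℝ g (y - x)) 0 := by
    have h1 : HasDerivAt (AffineMap.lineMap (k := ℝ) x y) (y - x) (0 : ℝ) :=
      AffineMap.hasDerivAt_lineMap
    have h2 : HasFDerivAt φ (InnerProductSpace.toDual ℝ V g)
        (AffineMap.lineMap (k := ℝ) x y (0 : ℝ)) := by
      simpa using hg.hasFDerivAt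
    simpa using h2.comp_hasDerivAt (0 : ℝ) h1
  have h := hc.le_slope_of_hasDerivAt (Set.mem_univ 0) (Set.mem_univ 1) one_pos hd
  simp [slope_def_field] at h
  linarith

theorem inner_gradient_sub_nonneg (hφ : ConvexOn ℝ Set.univ φ) (hd : Differentiable ℝ φ)
    (x y : V) : 0 ≤ inner ℝ (gradient φ x - gradient φ y) (x - y) := by
  have h1 := add_inner_le_of_convexOn hφ (hd x).hasGradientAt y
  have h2 := add_inner_le_of_convexOn hφ (hd y).hasGradientAt x
  rw [← neg_sub x y, inner_neg_right] at h1
  rw [inner_sub_left]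
  linarith

theorem hasGradientAt_const_mul_norm_sq_sub (c : ℝ) (a x : V) :
    HasGradientAt (fun x => c / 2 * ‖x - a‖ ^ 2) (c • (x - a)) x := by
  rw [hasGradientAt_iff_hasFDerivAt]
  have h := (((hasFDerivAt_id x).sub_const a).norm_sq).const_mul (c / 2)
  refine h.congr_fderiv ?_
  ext y
  simp
  ring

theorem hasGradientAt_add {f₁ f₂ : V → ℝ} {g₁ g₂ x : V} (h₁ : HasGradientAt f₁ g₁ x)
    (h₂ : HasGradientAt f₂ g₂ x) : HasGradientAt (fun x => f₁ x + f₂ x) (g₁ + g₂) x := by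
  rw [hasGradientAt_iff_hasFDerivAt, map_add] at *
  exact h₁.add h₂

/-- The quadratic makes `c / 2 * ‖x - a‖ ^ 2 + φ x` coercive, and its minimizer is the solution.
This is the surjectivity that makes `resolvent` a genuine inverse. -/
theorem exists_smul_sub_add_gradient_eq_zero [FiniteDimensional ℝ V] (hd : Differentiable ℝ φ)
    (hb : BddBelow (Set.range φ)) {c : ℝ} (hc : 0 < c) (a : V) :
    ∃ x, c • (x - a) + gradient φ x = 0 := by
  obtain ⟨b, hb⟩ := hb
  have hb' : ∀ x, b ≤ φ x := fun x => hb ⟨x, rfl⟩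
  have hcont : Continuous fun x => c / 2 * ‖x - a‖ ^ 2 + φ x := by
    have := hd.continuous
    fun_prop
  have hlim : Tendsto (fun x => c / 2 * ‖x - a‖ ^ 2 + φ x) (cocompact V) atTop := by
    refine tendsto_atTop_add_right_of_le _ b ?_ hb'
    refine Tendsto.const_mul_atTop (by positivity) ?_
    refine (tendsto_pow_atTop two_ne_zero).comp ?_
    have h1 : Tendsto (fun x : V => x - a) (cocompact V) (cocompact V) :=
      (Homeomorph.subRight a).isClosedEmbedding.tendsto_cocompact
    exact (tendsto_norm_cocompact_atTop (E := V)).comp h1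
  obtain ⟨x, hx⟩ := hcont.exists_forall_le hlim
  refine ⟨x, ?_⟩
  have hg := hasGradientAt_add (hasGradientAt_const_mul_norm_sq_sub c a x) (hd x).hasGradientAt
  have hmin : IsLocalMin (fun x => c / 2 * ‖x - a‖ ^ 2 + φ x) x := Eventually.of_forall hx
  have h0 := hmin.hasFDerivAt_eq_zero hg.hasFDerivAt
  exact (LinearIsometryEquiv.map_eq_zero_iff _).1 h0

end Convex

/-! ### Convergence of the primal-dual iteration. -/

section PrimalDual

variable {V W : Type*} [NormedAddCommGroup V] [InnerProductSpace ℝ V]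
  [NormedAddCommGroup W] [InnerProductSpace ℝ W]

/-- The squared primal-dual distance `p ‖x‖² + q ‖y‖² - 2 ⟪A x, y⟫`. -/
def primalDualEnergy (A : V →ₗ[ℝ] W) (p q : ℝ) (x : V) (y : W) : ℝ :=
  p * ‖x‖ ^ 2 + q * ‖y‖ ^ 2 - 2 * inner ℝ (A x) y

theorem primalDualEnergy_nonneg {A : V →ₗ[ℝ] W} {p q r : ℝ} (hp : 0 < p)
    (hA : ∀ x, ‖A x‖ ≤ r * ‖x‖) (hr : r ^ 2 ≤ p * q) (x : V) (y : W) :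
    0 ≤ primalDualEnergy A p q x y := by
  have h1 : inner ℝ (A x) y ≤ r * ‖x‖ * ‖y‖ :=
    (real_inner_le_norm _ _).trans (mul_le_mul_of_nonneg_right (hA x) (norm_nonneg y))
  -- After multiplication by `p` this is the square `(p * ‖x‖ - r * ‖y‖) ^ 2` plus `(p * q - r ^ 2)
  -- * ‖y‖ ^ 2`.
  have h2 : 0 ≤ p * (p * ‖x‖ ^ 2 + q * ‖y‖ ^ 2 - 2 * (r * ‖x‖ * ‖y‖)) := by
    nlinarith [sq_nonneg (p * ‖x‖ - r * ‖y‖), mul_le_mul_of_nonneg_right hr (sq_nonneg ‖y‖)]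
  have h3 := nonneg_of_mul_nonneg_right h2 hp
  unfold primalDualEnergy
  linarith

/-- One step of the primal-dual iteration decreases the primal-dual distance to a saddle point. -/
theorem primalDualEnergy_step {A : V →ₗ[ℝ] W} {A' : W →ₗ[ℝ] V}
    (hAA : ∀ x y, inner ℝ (A x) y = inner ℝ x (A' y)) {p q μ : ℝ} {G : W → W}
    (hG : ∀ x y, 0 ≤ inner ℝ (G x - G y) (x - y))
    (henergy : ∀ x y, 0 ≤ primalDualEnergy A p q x y) {a vs v v' : V} {w w' z : W}
    (hs : μ • (vs - a) + A' (G (A vs)) = 0)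
    (hv : p • (v - v') - A' w = μ • (v' - a))
    (hw : w' = G z) (hz : z = q • (w - w') + A ((2 : ℝ) • v' - v)) :
    primalDualEnergy A p q (v' - vs) (w' - G (A vs)) + 2 * μ * ‖v' - vs‖ ^ 2
      ≤ primalDualEnergy A p q (v - vs) (w - G (A vs)) := by
  have h0 := henergy (v - v') (w - w')
  have h1 := hG z (A vs)
  rw [← hw, hz] at h1
  set ws := G (A vs) with hws
  obtain ⟨X, rfl⟩ : ∃ X, v = vs + X := ⟨v - vs, by abel⟩
  obtain ⟨X', rfl⟩ : ∃ X', v' = vs + X' := ⟨v' - vs, by abel⟩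
  obtain ⟨Y, rfl⟩ : ∃ Y, w = ws + Y := ⟨w - ws, by abel⟩
  obtain ⟨Y', hY'⟩ : ∃ Y', w' = ws + Y' := ⟨w' - ws, by abel⟩
  clear hw hz
  subst hY'
  have e1 : A' Y = p • (X - X') - μ • X' := by
    have : A' (ws + Y) = p • (X - X') - μ • (vs + X' - a) := by
      rw [← hv]; simp
    rw [map_add] at this
    have h3 : A' ws = - (μ • (vs - a)) := by rw [← sub_eq_zero, sub_neg_eq_add, add_comm]; exact hs
    rw [h3] at this
    have h4 : A' Y = p • (X - X') - μ • (vs + X' - a) + μ • (vs - a) := by rw [← this]; abel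
    rw [h4]; module
  have e2 : inner ℝ (A X') Y = p * inner ℝ X' X - p * ‖X'‖ ^ 2 - μ * ‖X'‖ ^ 2 := by
    rw [hAA, e1, inner_sub_right, inner_smul_right, inner_sub_right, inner_smul_right,
      real_inner_self_eq_norm_sq]
    ring
  have e3 : q • (ws + Y - (ws + Y')) + A ((2 : ℝ) • (vs + X') - (vs + X)) - A vs
      = q • (Y - Y') + ((2 : ℝ) • A X' - A X) := by
    simp only [map_sub, map_add, map_smul]; module
  rw [e3] at h1
  simp only [add_sub_add_left_eq_sub, add_sub_cancel_left, primalDualEnergy] at h0 h1 ⊢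
  simp only [inner_add_right, inner_sub_right, inner_smul_right, inner_sub_left, map_sub,
    norm_sub_sq_real, real_inner_self_eq_norm_sq, real_inner_comm _ (A X),
    real_inner_comm _ (A X')] at h0 h1 ⊢
  rw [real_inner_comm] at e2
  rw [real_inner_comm X X', real_inner_comm Y Y'] at *
  -- The energy drop equals the energy of the move (`h0`), plus twice the monotonicity term (`h1`),
  -- plus `2 * μ * ‖X'‖ ^ 2`; the last comes from primal optimality (`e2`).
  nlinarith

/-- Telescoping the energy makes the surplus `2 * μ * ‖v (l + 1) - vs‖ ^ 2` summable. Writing the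
dual iterate as `G (z l)` avoids conjugate functions, and no convergence of `w` is needed. -/
theorem tendsto_of_primalDual {A : V →ₗ[ℝ] W} {A' : W →ₗ[ℝ] V}
    (hAA : ∀ x y, inner ℝ (A x) y = inner ℝ x (A' y)) {p q μ : ℝ} (hμ : 0 < μ) {G : W → W}
    (hG : ∀ x y, 0 ≤ inner ℝ (G x - G y) (x - y))
    (henergy : ∀ x y, 0 ≤ primalDualEnergy A p q x y) {a vs : V} {v : ℕ → V} {w z : ℕ → W}
    (hs : μ • (vs - a) + A' (G (A vs)) = 0)
    (hv : ∀ l, p • (v l - v (l + 1)) - A' (w l) = μ • (v (l + 1) - a))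
    (hw : ∀ l, w (l + 1) = G (z l))
    (hz : ∀ l, z l = q • (w l - w (l + 1)) + A ((2 : ℝ) • v (l + 1) - v l)) :
    Tendsto v atTop (𝓝 vs) := by
  have hstep := fun l => primalDualEnergy_step hAA hG henergy hs (hv l) (hw l) (hz l)
  have hsum : Summable fun l => 2 * μ * ‖v (l + 1) - vs‖ ^ 2 := by
    refine summable_of_sum_range_le (fun l => by positivity) (fun N => ?_)
      (c := primalDualEnergy A p q (v 0 - vs) (w 0 - G (A vs)))
    have : ∑ l ∈ Finset.range N, 2 * μ * ‖v (l + 1) - vs‖ ^ 2 ≤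
        primalDualEnergy A p q (v 0 - vs) (w 0 - G (A vs)) -
          primalDualEnergy A p q (v N - vs) (w N - G (A vs)) := by
      induction N with
      | zero => simp
      | succ N ih => rw [Finset.sum_range_succ]; linarith [hstep N]
    linarith [henergy (v N - vs) (w N - G (A vs))]
  have h1 : Tendsto (fun l => ‖v (l + 1) - vs‖ ^ 2) atTop (𝓝 0) := by
    have h := hsum.tendsto_atTop_zero.const_mul (1 / (2 * μ))
    rw [mul_zero] at h
    refine h.congr fun l => ?_
    field_simp
  have h2 : Tendsto (fun l => ‖v (l + 1) - vs‖) atTop (𝓝 0) := by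
    simpa using h1.sqrt
  exact (tendsto_add_atTop_iff_nat 1).1 (tendsto_iff_norm_sub_tendsto_zero.2 h2)

end PrimalDual

/-! ### Inexact orbits of nonexpansive maps. -/

section Nonexpansive

/-- Subtracting the partial sums of `ε` leaves an antitone sequence that is bounded below. -/
theorem exists_tendsto_of_le_add_summable {a ε : ℕ → ℝ} (ha : ∀ k, 0 ≤ a k)
    (hε : Summable ε) (h : ∀ k, a (k + 1) ≤ a k + ε k) : ∃ l, Tendsto a atTop (𝓝 l) := by
  have hS := hε.hasSum.tendsto_sum_nat
  have hanti : Antitone fun k => a k - ∑ i ∈ Finset.range k, ε i :=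
    antitone_nat_of_succ_le fun k => by rw [Finset.sum_range_succ]; linarith [h k]
  obtain ⟨M, hM⟩ := hS.bddAbove_range
  have hb : BddBelow (Set.range fun k => a k - ∑ i ∈ Finset.range k, ε i) := by
    refine ⟨-M, ?_⟩
    rintro _ ⟨k, rfl⟩
    have := hM ⟨k, rfl⟩
    simp only at this ⊢
    linarith [ha k]
  refine ⟨_, ((tendsto_atTop_ciInf hanti hb).add hS).congr fun k => ?_⟩
  ring

/-- Asymptotically regular inexact orbits, with summable errors, of a nonexpansive map that has a
fixed point converge to a fixed point. -/
theorem exists_tendsto_fixedPoint {X : Type*} [MetricSpace X] [ProperSpace X] {f : X → X}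
    (hf : LipschitzWith 1 f) {x : ℕ → X} {ε : ℕ → ℝ} (hε : Summable ε)
    (hx : ∀ k, dist (x (k + 1)) (f (x k)) ≤ ε k)
    (hreg : Tendsto (fun k => dist (x (k + 1)) (x k)) atTop (𝓝 0)) {z : X} (hz : f z = z) :
    ∃ y, f y = y ∧ Tendsto x atTop (𝓝 y) := by
  have key : ∀ y, f y = y → ∃ l, Tendsto (fun k => dist (x k) y) atTop (𝓝 l) := by
    intro y hy
    refine exists_tendsto_of_le_add_summable (fun _ => dist_nonneg) hε fun k => ?_
    have h1 := dist_triangle (x (k + 1)) (f (x k)) y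
    have h2 := hf.dist_le_mul (x k) y
    rw [hy] at h2
    simp only [NNReal.coe_one, one_mul] at h2
    linarith [hx k]
  obtain ⟨l, hl⟩ := key z hz
  obtain ⟨M, hM⟩ := hl.bddAbove_range
  obtain ⟨y, -, s, hs, hy⟩ := (isCompact_closedBall z M).tendsto_subseq
    (x := x) fun k => hM ⟨k, rfl⟩
  have hfy : f y = y := by
    have h1 : Tendsto (fun k => dist (x (k + 1)) (f (x k))) atTop (𝓝 0) :=
      squeeze_zero (fun _ => dist_nonneg) hx hε.tendsto_atTop_zero
    have h2 : Tendsto (fun k => dist (f (x k)) (x k)) atTop (𝓝 0) := by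
      refine squeeze_zero (fun _ => dist_nonneg) (fun k => ?_) (by simpa using h1.add hreg)
      rw [dist_comm (x (k + 1)) (f (x k))]
      exact dist_triangle _ _ _
    have h3 : Tendsto (fun k => dist (f (x (s k))) (x (s k))) atTop (𝓝 (dist (f y) y)) :=
      ((hf.continuous.tendsto y).comp hy).dist hy
    exact dist_eq_zero.1 (tendsto_nhds_unique h3 (h2.comp hs.tendsto_atTop))
  refine ⟨y, hfy, ?_⟩
  -- Now `key` is applied to the cluster point itself: its distances converge, and to zero along a
  -- subsequence.
  obtain ⟨l', hl'⟩ := key y hfy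
  have h4 : l' = 0 := tendsto_nhds_unique (hl'.comp hs.tendsto_atTop)
    (tendsto_iff_dist_tendsto_zero.1 hy)
  exact tendsto_iff_dist_tendsto_zero.2 (h4 ▸ hl')

end Nonexpansive

/-! ### Matrices as operators; `D` is an isometry. -/

section Matrices

theorem inner_mulV {k l : ℕ} (A : Matrix (Fin k) (Fin l) ℝ) (x : E l) (y : E k) :
    inner ℝ (mulV A x) y = inner ℝ x (mulV Aᵀ y) := by
  have h := Matrix.toEuclideanLin_conjTranspose_eq_adjoint A
  rw [Matrix.conjTranspose_eq_transpose_of_trivial] at h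
  rw [mulV, mulV, h, LinearMap.adjoint_inner_right]

theorem continuous_mulV {k l : ℕ} (A : Matrix (Fin k) (Fin l) ℝ) : Continuous (mulV A) :=
  LinearMap.continuous_of_finiteDimensional _

variable {n m : ℕ} {D : Matrix (Fin n) (Fin m) ℝ}

theorem mulV_transpose_mulV (hD : Dᵀ * D = 1) (v : E m) : mulV Dᵀ (mulV D v) = v := by
  ext i
  simp [mulV, Matrix.toLpLin_apply, Matrix.mulVec_mulVec, hD]

theorem norm_mulV (hD : Dᵀ * D = 1) (v : E m) : ‖mulV D v‖ = ‖v‖ := by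
  rw [← sq_eq_sq₀ (norm_nonneg _) (norm_nonneg _), ← real_inner_self_eq_norm_sq, inner_mulV,
    mulV_transpose_mulV hD, real_inner_self_eq_norm_sq]

theorem norm_mulV_transpose_le (hD : Dᵀ * D = 1) (u : E n) : ‖mulV Dᵀ u‖ ≤ ‖u‖ := by
  have h1 : ‖mulV Dᵀ u‖ * ‖mulV Dᵀ u‖ ≤ ‖u‖ * ‖mulV Dᵀ u‖ := by
    rw [← real_inner_self_eq_norm_mul_norm, inner_mulV, Matrix.transpose_transpose]
    refine (real_inner_le_norm _ _).trans ?_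
    rw [norm_mulV hD]
  rcases (norm_nonneg (mulV Dᵀ u)).eq_or_lt with h | h
  · rw [← h]; positivity
  · exact le_of_mul_le_mul_right h1 h

theorem mulV_diagMask_apply (C : Finset (Fin n)) (x : E n) (i : Fin n) :
    mulV (diagMask C) x i = if i ∈ C then x i else 0 := by
  simp [mulV, diagMask, Matrix.toLpLin_apply, Matrix.mulVec_diagonal]

theorem norm_mulV_diagMask_le (C : Finset (Fin n)) (x : E n) : ‖mulV (diagMask C) x‖ ≤ ‖x‖ := by
  rw [← sq_le_sq₀ (norm_nonneg _) (norm_nonneg _), EuclideanSpace.real_norm_sq_eq,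
    EuclideanSpace.real_norm_sq_eq]
  refine Finset.sum_le_sum fun i _ => ?_
  rw [mulV_diagMask_apply]
  split_ifs
  · exact le_rfl
  · simpa using sq_nonneg (x i)

end Matrices

/-! ### Resolvents of gradients. -/

section Resolvent

variable {k : ℕ} {φ : E k → ℝ} {t : ℝ}

theorem resolvent_add_smul_gradient (hd : Differentiable ℝ φ) (hb : BddBelow (Set.range φ))
    (ht : 0 < t) (y : E k) :
    resolvent (gradient φ) t y + t • gradient φ (resolvent (gradient φ) t y) = y := by
  refine Function.invFun_eq (f := fun y => y + t • gradient φ y) ?_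
  obtain ⟨x, hx⟩ := exists_smul_sub_add_gradient_eq_zero hd hb (inv_pos.2 ht) y
  refine ⟨x, ?_⟩
  have h := congrArg (fun z => t • z) hx
  simp only [smul_add, smul_zero, smul_inv_smul₀ ht.ne'] at h
  rw [← sub_eq_zero, ← h]
  abel

theorem norm_resolvent_sub_le (hφ : ConvexOn ℝ Set.univ φ) (hd : Differentiable ℝ φ)
    (hb : BddBelow (Set.range φ)) (ht : 0 < t) (x y : E k) :
    ‖resolvent (gradient φ) t x - resolvent (gradient φ) t y‖ ≤ ‖x - y‖ := by
  have h := norm_sub_le_of_monotone (inner_gradient_sub_nonneg hφ hd) ht.le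
    (resolvent (gradient φ) t x) (resolvent (gradient φ) t y)
  rwa [resolvent_add_smul_gradient hd hb ht, resolvent_add_smul_gradient hd hb ht] at h

theorem resolvent_eq (hφ : ConvexOn ℝ Set.univ φ) (hd : Differentiable ℝ φ)
    (hb : BddBelow (Set.range φ)) (ht : 0 < t) (x : E k) :
    resolvent (gradient φ) t (x + t • gradient φ x) = x := by
  have h := norm_sub_le_of_monotone (inner_gradient_sub_nonneg hφ hd) ht.le
    (resolvent (gradient φ) t (x + t • gradient φ x)) x
  rw [resolvent_add_smul_gradient hd hb ht, sub_self, norm_zero, norm_le_zero_iff] at h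
  exact sub_eq_zero.1 h

end Resolvent

/-! ### The proximity operator of the counting norm. -/

section HardThreshold

variable {n : ℕ}

theorem l0norm_eq_card (u : E n) : l0norm u = (supp u).card := rfl

theorem l0norm_eq_sum (u : E n) : l0norm u = ∑ i, if u i ≠ 0 then (1 : ℝ) else 0 := by
  rw [l0norm_eq_card, supp, Finset.card_filter]
  push_cast
  rfl

theorem mem_supp {u : E n} {i : Fin n} : i ∈ supp u ↔ u i ≠ 0 := by
  simp [supp]

theorem prox_objective_eq_sum (t : ℝ) (x y : E n) :
    1 / (2 * t) * ‖x - y‖ ^ 2 + l0norm x =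
      ∑ i, (1 / (2 * t) * (x i - y i) ^ 2 + if x i ≠ 0 then (1 : ℝ) else 0) := by
  rw [l0norm_eq_sum, EuclideanSpace.real_norm_sq_eq, Finset.mul_sum, ← Finset.sum_add_distrib]
  rfl

/-- The proximity operator of the number of nonzero components acts componentwise. -/
theorem mem_prox_l0norm_iff {t : ℝ} {x y : E n} :
    x ∈ prox l0norm t y ↔ ∀ (i : Fin n) (c : ℝ),
      1 / (2 * t) * (x i - y i) ^ 2 + (if x i ≠ 0 then (1 : ℝ) else 0) ≤
        1 / (2 * t) * (c - y i) ^ 2 + if c ≠ 0 then (1 : ℝ) else 0 := by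
  simp only [prox, Set.mem_ofPred_eq, prox_objective_eq_sum]
  constructor
  · intro h i c
    have h1 := h (WithLp.toLp 2 (Function.update x i c))
    rw [← Finset.add_sum_erase _ _ (Finset.mem_univ i),
      ← Finset.add_sum_erase _ (fun j => 1 / (2 * t) *
        ((WithLp.toLp 2 (Function.update x i c) : E n) j - y j) ^ 2 + _) (Finset.mem_univ i)] at h1
    have h2 : ∀ j ∈ Finset.univ.erase i,
        (1 / (2 * t) * ((WithLp.toLp 2 (Function.update x i c) : E n) j - y j) ^ 2 +
          if (WithLp.toLp 2 (Function.update x i c) : E n) j ≠ 0 then (1 : ℝ) else 0) =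
        1 / (2 * t) * (x j - y j) ^ 2 + if x j ≠ 0 then (1 : ℝ) else 0 := by
      intro j hj
      simp [Function.update_of_ne (Finset.ne_of_mem_erase hj)]
    rw [Finset.sum_congr rfl h2] at h1
    simp only [Function.update_self] at h1
    linarith
  · intro h z
    exact Finset.sum_le_sum fun i _ => h i (z i)

theorem prox_l0norm_nonempty {t : ℝ} (ht : 0 < t) (y : E n) : (prox l0norm t y).Nonempty := by
  -- Keeping a nonzero `y i` costs `1`, setting it to zero costs `y i ^ 2 / (2 * t)`; hence the
  -- threshold.
  refine ⟨WithLp.toLp 2 fun i => if 2 * t ≤ y i ^ 2 then y i else 0, ?_⟩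
  rw [mem_prox_l0norm_iff]
  intro i c
  have hc : 0 ≤ 1 / (2 * t) * (c - y i) ^ 2 := by positivity
  by_cases hy : 2 * t ≤ y i ^ 2
  · have h1 : 1 ≤ 1 / (2 * t) * y i ^ 2 := by
      rw [one_div, ← div_eq_inv_mul, le_div_iff₀ (by positivity)]; linarith
    rcases eq_or_ne c 0 with rfl | h0
    · simp only [hy, if_true]
      split_ifs <;> simp_all
    · have h2 : (if y i ≠ 0 then (1 : ℝ) else 0) ≤ 1 := by split_ifs <;> norm_num
      simp only [hy, if_true, if_pos h0, sub_self]
      linarith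
  · have h1 : 1 / (2 * t) * y i ^ 2 ≤ 1 := by
      rw [one_div, ← div_eq_inv_mul, div_le_iff₀ (by positivity)]; linarith
    rcases eq_or_ne c 0 with rfl | h0
    · simp [hy]
    · simp only [hy, if_false, if_pos h0]
      simp at h1 hc ⊢
      linarith

/-- Competitor `y i` forces the equality, competitor `0` forces the gap. The gap is what later
freezes the support. -/
theorem apply_of_mem_prox_l0norm {t : ℝ} (ht : 0 < t) {x y : E n} (hx : x ∈ prox l0norm t y)
    {i : Fin n} (hi : x i ≠ 0) : x i = y i ∧ 2 * t ≤ x i ^ 2 := by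
  rw [mem_prox_l0norm_iff] at hx
  have h1 := hx i (y i)
  have h2 := hx i 0
  have ht' : 0 < 1 / (2 * t) := by positivity
  have hxy : x i = y i := by
    have h3 : 1 / (2 * t) * (x i - y i) ^ 2 ≤ 0 := by
      have : (if y i ≠ 0 then (1 : ℝ) else 0) ≤ 1 := by split_ifs <;> norm_num
      simp only [if_pos hi, sub_self] at h1
      nlinarith
    have h4 : (x i - y i) ^ 2 ≤ 0 := nonpos_of_mul_nonpos_right h3 ht'
    nlinarith [pow_eq_zero_iff (two_ne_zero) |>.1 (le_antisymm h4 (sq_nonneg _))]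
  refine ⟨hxy, ?_⟩
  rw [if_pos hi, if_neg (by simp), ← hxy] at h2
  have h5 : 1 ≤ 1 / (2 * t) * x i ^ 2 := by linarith [h2, show (x i - x i) ^ 2 = 0 by ring,
    show 1 / (2 * t) * (x i - x i) ^ 2 = 0 by ring,
    show 1 / (2 * t) * (0 - x i) ^ 2 = 1 / (2 * t) * x i ^ 2 by ring]
  rw [one_div, ← div_eq_inv_mul, le_div_iff₀ (by positivity)] at h5
  linarith

end HardThreshold

/-! ### Optimality conditions, `S`, `T` and the inner loop. -/

section Smooth

variable {m d : ℕ} {ψ : E d → ℝ} {B : Matrix (Fin d) (Fin m) ℝ}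

theorem hasGradientAt_comp_mulV (hd : Differentiable ℝ ψ) (v : E m) :
    HasGradientAt (fun v => ψ (mulV B v)) (mulV Bᵀ (gradient ψ (mulV B v))) v := by
  rw [hasGradientAt_iff_hasFDerivAt]
  have h := (hd (mulV B v)).hasGradientAt.hasFDerivAt.comp v
    (LinearMap.toContinuousLinearMap (Matrix.toEuclideanLin B)).hasFDerivAt
  refine h.congr_fderiv ?_
  ext x
  simpa [real_inner_comm] using inner_mulV B x (gradient ψ (mulV B v))

theorem differentiable_comp_mulV (hd : Differentiable ℝ ψ) :
    Differentiable ℝ fun v => ψ (mulV B v) :=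
  fun v => (hasGradientAt_comp_mulV hd v).differentiableAt

theorem convexOn_comp_mulV (hψ : ConvexOn ℝ Set.univ ψ) :
    ConvexOn ℝ Set.univ fun v => ψ (mulV B v) := by
  exact hψ.comp_linearMap (Matrix.toEuclideanLin B)

theorem bddBelow_comp_mulV (hb : BddBelow (Set.range ψ)) :
    BddBelow (Set.range fun v => ψ (mulV B v)) :=
  hb.mono (Set.range_comp_subset_range _ ψ)

theorem continuous_gradient (hd : ContDiff ℝ 1 ψ) : Continuous (gradient ψ) :=
  (InnerProductSpace.toDual ℝ (E d)).symm.continuous.comp (hd.continuous_fderiv one_ne_zero)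

variable {n : ℕ} {D : Matrix (Fin n) (Fin m) ℝ} {lam gam : ℝ}

theorem gradH_eq (hd : Differentiable ℝ ψ) (v : E m) (u : E n) :
    gradH ψ B D lam gam v u =
      (lam / gam) • (v - mulV Dᵀ u) + gradient (fun v => ψ (mulV B v)) v := by
  refine HasGradientAt.gradient ?_
  have h := hasGradientAt_add (hasGradientAt_const_mul_norm_sq_sub (lam / gam) (mulV Dᵀ u) v)
    (differentiable_comp_mulV (B := B) hd v).hasGradientAt
  have e : lam / gam / 2 = lam / (2 * gam) := by rw [div_div, mul_comm]
  rw [e] at h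
  exact h

theorem continuous_gradH (hd : ContDiff ℝ 1 ψ) (u : E n) :
    Continuous fun v => gradH ψ B D lam gam v u := by
  have hd' := hd.differentiable one_ne_zero
  simp only [gradH_eq hd', (hasGradientAt_comp_mulV hd' _).gradient]
  have h1 := (continuous_mulV Bᵀ).comp ((continuous_gradient hd).comp (continuous_mulV B))
  exact ((continuous_id.sub continuous_const).const_smul (lam / gam)).add h1

theorem continuous_smooth_part (hd : Continuous ψ) :
    Continuous fun z : E n × E m =>
      ψ (mulV B z.2) + lam / (2 * gam) * ‖z.1 - mulV D z.2‖ ^ 2 := by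
  have h1 := (continuous_mulV B).comp (continuous_snd (X := E n))
  have h2 := (continuous_mulV D).comp (continuous_snd (X := E n))
  exact (hd.comp h1).add (((continuous_fst.sub h2).norm.pow 2).const_mul _)

theorem continuous_F_right (hd : Continuous ψ) (u : E n) :
    Continuous fun v => F ψ B D lam gam u v :=
  ((continuous_smooth_part hd).comp (Continuous.prodMk_right u)).add continuous_const

/-- First-order lower bound for the smooth part of `F`. -/
theorem smooth_part_lower_bound (hψ : ConvexOn ℝ Set.univ ψ) (hd : Differentiable ℝ ψ)
    (hl : 0 < lam) (hg : 0 < gam) {us u : E n} {vs v : E m}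
    (hv : gradH ψ B D lam gam vs us = 0) (hD : Dᵀ * D = 1)
    (hu : inner ℝ (us - mulV D vs) (u - us) = 0) :
    ψ (mulV B vs) + lam / (2 * gam) * ‖us - mulV D vs‖ ^ 2 +
        lam / (2 * gam) * ‖(u - us) - mulV D (v - vs)‖ ^ 2 ≤
      ψ (mulV B v) + lam / (2 * gam) * ‖u - mulV D v‖ ^ 2 := by
  have h1 := add_inner_le_of_convexOn (convexOn_comp_mulV (B := B) hψ)
    (differentiable_comp_mulV hd vs).hasGradientAt v
  rw [gradH_eq hd, add_eq_zero_iff_neg_eq] at hv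
  rw [← hv, inner_neg_left, real_inner_smul_left] at h1
  have h2 : u - mulV D v = (us - mulV D vs) + ((u - us) - mulV D (v - vs)) := by
    simp only [mulV, map_sub]; abel
  -- Since `Dᵀ D = I`, the cross term of the expanded square cancels the linear term of `h1`,
  -- leaving only the quadratic remainder.
  have h3 : inner ℝ (us - mulV D vs) (mulV D (v - vs)) =
      - inner ℝ (vs - mulV Dᵀ us) (v - vs) := by
    rw [real_inner_comm, inner_mulV, mulV, map_sub, ← mulV, ← mulV, mulV_transpose_mulV hD,
      real_inner_comm, ← inner_neg_left, neg_sub]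
  rw [h2, norm_add_sq_real, inner_sub_right, hu, h3]
  have h4 : lam / gam = 2 * (lam / (2 * gam)) := by field_simp
  rw [h4] at h1
  linarith

/-- Quadratic growth of `F u` at a critical point. -/
theorem F_add_le (hψ : ConvexOn ℝ Set.univ ψ) (hd : Differentiable ℝ ψ)
    (hl : 0 < lam) (hg : 0 < gam) (hD : Dᵀ * D = 1) {u : E n} {vs : E m}
    (hv : gradH ψ B D lam gam vs u = 0) (v : E m) :
    F ψ B D lam gam u vs + lam / (2 * gam) * ‖v - vs‖ ^ 2 ≤ F ψ B D lam gam u v := by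
  have h := smooth_part_lower_bound (u := u) (v := v) hψ hd hl hg hv hD (by simp)
  rw [sub_self, zero_sub, norm_neg, norm_mulV hD] at h
  unfold F
  linarith

/-- A point that is critical on its own support is a local minimizer. -/
theorem isLocalMin_F (hψ : ConvexOn ℝ Set.univ ψ) (hd : Differentiable ℝ ψ)
    (hl : 0 < lam) (hg : 0 < gam) (hD : Dᵀ * D = 1) {us : E n} {vs : E m}
    (hv : gradH ψ B D lam gam vs us = 0) (hu : ∀ i ∈ supp us, us i = mulV D vs i) :
    IsLocalMin (fun z : E n × E m => F ψ B D lam gam z.1 z.2) (us, vs) := by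
  have h1 : ∀ᶠ z : E n × E m in 𝓝 (us, vs), ∀ i ∈ supp us, i ∈ supp z.1 := by
    refine (Finset.eventually_all _).2 fun i hi => ?_
    have hc : Continuous fun z : E n × E m => z.1 i := by fun_prop
    filter_upwards [hc.continuousAt.eventually_ne (x := (us, vs)) (mem_supp.1 hi)] with z hz
    exact mem_supp.2 hz
  have h2 := (continuous_smooth_part (n := n) (B := B) (D := D) (lam := lam) (gam := gam)
    hd.continuous).continuousAt (x := (us, vs))
  -- Near the point the smooth part drops by less than `lam`, the price of one additional nonzero
  -- entry.
  have h3 := h2.eventually (lt_mem_nhds (sub_lt_self _ hl))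
  filter_upwards [h1, h3] with z hz hz'
  have hsub : supp us ⊆ supp z.1 := hz
  simp only [F, l0norm_eq_card] at hz' ⊢
  rcases hsub.eq_or_ssubset with heq | hss
  · have h4 : inner ℝ (us - mulV D vs) (z.1 - us) = 0 := by
      rw [PiLp.inner_apply]
      refine Finset.sum_eq_zero fun i _ => ?_
      by_cases hi : i ∈ supp us
      · simp [hu i hi]
      · have hi' : i ∉ supp z.1 := heq ▸ hi
        rw [mem_supp, not_not] at hi hi'
        simp [hi, hi']
    have h5 := smooth_part_lower_bound (u := z.1) (v := z.2) hψ hd hl hg hv hD h4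
    have h6 : 0 ≤ lam / (2 * gam) * ‖(z.1 - us) - mulV D (z.2 - vs)‖ ^ 2 := by positivity
    rw [← heq]
    linarith
  · have h4 : ((supp us).card : ℝ) + 1 ≤ (supp z.1).card := by
      exact_mod_cast Finset.card_lt_card hss
    nlinarith

theorem gradH_S (hd : Differentiable ℝ ψ) (hb : BddBelow (Set.range ψ))
    (hl : 0 < lam) (hg : 0 < gam) (u : E n) :
    gradH ψ B D lam gam (S ψ B lam gam (mulV Dᵀ u)) u = 0 := by
  have h := resolvent_add_smul_gradient (differentiable_comp_mulV (B := B) hd)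
    (bddBelow_comp_mulV hb) (div_pos hg hl) (mulV Dᵀ u)
  rw [gradH_eq hd, S]
  set x := resolvent (gradient fun v : E m => ψ (mulV B v)) (gam / lam) (mulV Dᵀ u)
  rw [← h, sub_add_cancel_left, smul_neg, smul_smul, div_mul_div_cancel₀ hg.ne', div_self hl.ne',
    one_smul, neg_add_cancel]

theorem norm_S_sub_le (hψ : ConvexOn ℝ Set.univ ψ) (hd : Differentiable ℝ ψ)
    (hb : BddBelow (Set.range ψ)) (hl : 0 < lam) (hg : 0 < gam) (x y : E m) :
    ‖S ψ B lam gam x - S ψ B lam gam y‖ ≤ ‖x - y‖ :=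
  norm_resolvent_sub_le (convexOn_comp_mulV hψ) (differentiable_comp_mulV hd)
    (bddBelow_comp_mulV hb) (div_pos hg hl) x y

/-- Here `v` is `S` of a point that differs from `Dᵀ u` by `(gam / lam) • gradH`, and `S` is
nonexpansive. This turns the stopping test into a distance to the exact minimizer. -/
theorem norm_sub_S_le (hψ : ConvexOn ℝ Set.univ ψ) (hd : Differentiable ℝ ψ)
    (hb : BddBelow (Set.range ψ)) (hl : 0 < lam) (hg : 0 < gam) (v : E m) (u : E n) :
    ‖v - S ψ B lam gam (mulV Dᵀ u)‖ ≤ gam / lam * ‖gradH ψ B D lam gam v u‖ := by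
  have h1 : S ψ B lam gam (v + (gam / lam) • gradient (fun v => ψ (mulV B v)) v) = v :=
    resolvent_eq (convexOn_comp_mulV hψ) (differentiable_comp_mulV hd)
      (bddBelow_comp_mulV hb) (div_pos hg hl) v
  have h2 := norm_S_sub_le (B := B) hψ hd hb hl hg
    (v + (gam / lam) • gradient (fun v => ψ (mulV B v)) v) (mulV Dᵀ u)
  have h3 : v + (gam / lam) • gradient (fun v => ψ (mulV B v)) v - mulV Dᵀ u =
      (gam / lam) • gradH ψ B D lam gam v u := by
    rw [gradH_eq hd, smul_add, smul_smul, div_mul_div_cancel₀ hl.ne', div_self hg.ne', one_smul]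
    abel
  rw [h1, h3, norm_smul, Real.norm_of_nonneg (by positivity)] at h2
  exact h2

theorem norm_T_sub_le {α : ℝ} (hψ : ConvexOn ℝ Set.univ ψ) (hd : Differentiable ℝ ψ)
    (hb : BddBelow (Set.range ψ)) (hl : 0 < lam) (hg : 0 < gam) (hD : Dᵀ * D = 1)
    (hα0 : 0 ≤ α) (hα1 : α ≤ 1) (C : Finset (Fin n)) (x y : E n) :
    ‖T ψ B D lam gam α C x - T ψ B D lam gam α C y‖ ≤ ‖x - y‖ := by
  have h1 : T ψ B D lam gam α C x - T ψ B D lam gam α C y =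
      (1 - α) • mulV (diagMask C) (x - y) + α • mulV (diagMask C) (mulV D
        (S ψ B lam gam (mulV Dᵀ x) - S ψ B lam gam (mulV Dᵀ y))) := by
    simp only [T, mulV, map_sub]; module
  have h2 := norm_mulV_diagMask_le C (x - y)
  have h3 := norm_mulV_diagMask_le C (mulV D
    (S ψ B lam gam (mulV Dᵀ x) - S ψ B lam gam (mulV Dᵀ y)))
  have h4 := norm_S_sub_le (B := B) hψ hd hb hl hg (mulV Dᵀ x) (mulV Dᵀ y)
  have h5 := norm_mulV_transpose_le hD (x - y)
  rw [norm_mulV hD] at h3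
  rw [mulV, map_sub] at h5
  rw [h1]
  refine (norm_add_le _ _).trans ?_
  rw [norm_smul, norm_smul, Real.norm_of_nonneg (sub_nonneg.2 hα1), Real.norm_of_nonneg hα0]
  have h6 := mul_le_mul_of_nonneg_left h2 (sub_nonneg.2 hα1)
  have h7 := mul_le_mul_of_nonneg_left (h3.trans (h4.trans h5)) hα0
  linarith

/-- The inner loop converges to the minimizer of `H(·; u)`. -/
theorem tendsto_innerStep {p q : ℝ} (hψ : ConvexOn ℝ Set.univ ψ) (hd : Differentiable ℝ ψ)
    (hb : BddBelow (Set.range ψ)) (hl : 0 < lam) (hg : 0 < gam) (hp : 0 < p) (hq : 0 < q)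
    (hpq : ‖B‖ ^ 2 ≤ p * q) (u : E n) (v : E m) (w : E d) :
    Tendsto (fun l => ((innerStep ψ B D lam gam p q u)^[l] (v, w)).1) atTop
      (𝓝 (S ψ B lam gam (mulV Dᵀ u))) := by
  set s := fun l => (innerStep ψ B D lam gam p q u)^[l] (v, w) with hs
  have hstep : ∀ l, s (l + 1) = innerStep ψ B D lam gam p q u (s l) := fun l =>
    Function.iterate_succ_apply' _ _ _
  have hv : ∀ l, (s (l + 1)).1 = (lam / (p * gam + lam)) • mulV Dᵀ u
      + (p * gam / (p * gam + lam)) • ((s l).1 - (1 / p) • mulV Bᵀ (s l).2) := fun l => by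
    rw [hstep]; rfl
  have hw : ∀ l, (s (l + 1)).2 = (1 / q) •
      (q • (s l).2 + mulV B ((2 : ℝ) • (s (l + 1)).1 - (s l).1) - resolvent (gradient ψ) q
        (q • (s l).2 + mulV B ((2 : ℝ) • (s (l + 1)).1 - (s l).1))) := fun l => by
    rw [hstep]; rfl
  have hc := gradH_S (B := B) (D := D) hd hb hl hg u
  rw [gradH_eq hd, (hasGradientAt_comp_mulV hd _).gradient] at hc
  -- The dual point is `∇ψ(B vs)`, and `z l` is the resolvent value: Moreau's decomposition gives `w
  -- (l + 1) = ∇ψ (z l)`.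
  refine tendsto_of_primalDual (A := Matrix.toEuclideanLin B) (A' := Matrix.toEuclideanLin Bᵀ)
    (fun x y => inner_mulV B x y) (div_pos hl hg) (inner_gradient_sub_nonneg hψ hd)
    (primalDualEnergy_nonneg hp (r := ‖B‖) (fun x => B.l2_opNorm_mulVec x) hpq)
    (w := fun l => (s l).2)
    (z := fun l => resolvent (gradient ψ) q
      (q • (s l).2 + mulV B ((2 : ℝ) • (s (l + 1)).1 - (s l).1))) hc ?_ ?_ ?_
  · intro l
    rw [hv]
    have hpg : p * gam + lam ≠ 0 := by positivity
    match_scalars <;> field_simp <;> ring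
  · intro l
    have h := resolvent_add_smul_gradient hd hb hq
      (q • (s l).2 + mulV B ((2 : ℝ) • (s (l + 1)).1 - (s l).1))
    rw [hw, sub_eq_iff_eq_add'.2 h.symm, smul_smul, one_div_mul_cancel hq.ne', one_smul]
  · intro l
    have h := hw l
    rw [smul_sub, h, smul_smul, mul_one_div_cancel hq.ne', one_smul]
    simp only [mulV]
    abel

end Smooth

/-! ### One outer step: termination and descent. -/

variable {n m d : ℕ} {ψ : E d → ℝ} {B : Matrix (Fin d) (Fin m) ℝ} {D : Matrix (Fin n) (Fin m) ℝ}
  {lam gam α ρ p q : ℝ}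

theorem exists_innerResult {ε : ℝ} (hψ : ConvexOn ℝ Set.univ ψ) (hd : ContDiff ℝ 1 ψ)
    (hb : BddBelow (Set.range ψ)) (hl : 0 < lam) (hg : 0 < gam) (hD : Dᵀ * D = 1) (hρ : 0 < ρ)
    (hp : 0 < p) (hq : 0 < q) (hpq : ‖B‖ ^ 2 ≤ p * q) (hε : 0 < ε) (u uNew : E n) (v : E m)
    (w : E d) : ∃ vNew wNew, InnerResult ψ B D lam gam ρ p q ε u uNew v w vNew wNew := by
  by_cases hpos : ‖uNew - u‖ ^ 2 + ‖gradH ψ B D lam gam v uNew‖ ^ 2 > 0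
  swap
  · exact ⟨v, w, fun h => absurd h hpos, fun _ => ⟨rfl, rfl⟩⟩
  have hd' := hd.differentiable one_ne_zero
  set vs := S ψ B lam gam (mulV Dᵀ uNew) with hvs
  have hlim := tendsto_innerStep (p := p) (D := D) hψ hd' hb hl hg hp hq hpq uNew v w
  have hcrit : gradH ψ B D lam gam vs uNew = 0 := gradH_S hd' hb hl hg uNew
  have hgrad : ∀ᶠ l in atTop, ‖gradH ψ B D lam gam
      ((innerStep ψ B D lam gam p q uNew)^[l] (v, w)).1 uNew‖ < ε := by
    have h := (((continuous_gradH (B := B) (D := D) (lam := lam) (gam := gam) hd uNew).norm).tendsto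
      vs).comp hlim
    rw [hcrit, norm_zero] at h
    exact h.eventually (gt_mem_nhds hε)
  -- Strictness has two sources: the slack in `ρ` if `uNew ≠ u`; otherwise the positive test
  -- quantity forces `v ≠ vs`, and quadratic growth applies.
  have hlt : F ψ B D lam gam uNew vs < F ψ B D lam gam uNew v + ρ / 2 * ‖uNew - u‖ ^ 2 := by
    have h1 := F_add_le hψ hd' hl hg hD hcrit v
    by_cases h : uNew = u
    · have hne : v ≠ vs := by
        rintro rfl
        simp [h ▸ hcrit, h] at hpos
      have h2 : 0 < lam / (2 * gam) * ‖v - vs‖ ^ 2 := by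
        have := norm_pos_iff.2 (sub_ne_zero.2 hne)
        positivity
      have h3 : 0 ≤ ρ / 2 * ‖uNew - u‖ ^ 2 := by positivity
      linarith
    · have h2 : 0 ≤ lam / (2 * gam) * ‖v - vs‖ ^ 2 := by positivity
      have h3 : 0 < ρ / 2 * ‖uNew - u‖ ^ 2 := by
        have := norm_pos_iff.2 (sub_ne_zero.2 h)
        positivity
      linarith
  have hval := (((continuous_F_right (B := B) (D := D) (lam := lam) (gam := gam) hd.continuous
    uNew).tendsto vs).comp hlim).eventually (gt_mem_nhds hlt)
  have hexit : ∃ l, 1 ≤ l ∧ ¬ Continues ψ B D lam gam ρ ε u uNew v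
      ((innerStep ψ B D lam gam p q uNew)^[l] (v, w)).1 := by
    obtain ⟨l, h1, h2, h3⟩ := (hgrad.and (hval.and (eventually_ge_atTop 1))).exists
    refine ⟨l, h3, ?_⟩
    rintro (h | h)
    · simp only [Function.comp_apply] at h2
      linarith
    · exact absurd h1 (not_lt.2 h.le)
  classical
  refine ⟨((innerStep ψ B D lam gam p q uNew)^[Nat.find hexit] (v, w)).1,
    ((innerStep ψ B D lam gam p q uNew)^[Nat.find hexit] (v, w)).2,
    fun _ => ⟨Nat.find hexit, (Nat.find_spec hexit).1, fun l h1 h2 => ?_,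
      (Nat.find_spec hexit).2, rfl⟩, fun h => absurd hpos h⟩
  have h := Nat.find_min hexit h2
  push Not at h
  exact h h1

theorem InnerResult.bounds {ε : ℝ} {u uNew : E n} {v vNew : E m} {w wNew : E d} (hε : 0 ≤ ε)
    (hρ : 0 ≤ ρ) (h : InnerResult ψ B D lam gam ρ p q ε u uNew v w vNew wNew) :
    F ψ B D lam gam uNew vNew - F ψ B D lam gam uNew v ≤ ρ / 2 * ‖uNew - u‖ ^ 2 ∧
      ‖gradH ψ B D lam gam vNew uNew‖ ≤ ε := by
  by_cases hpos : ‖uNew - u‖ ^ 2 + ‖gradH ψ B D lam gam v uNew‖ ^ 2 > 0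
  · obtain ⟨L, -, -, h2, h3⟩ := h.1 hpos
    rw [← h3, Continues, not_or, not_lt, not_lt] at h2
    exact h2
  · obtain ⟨rfl, rfl⟩ := h.2 hpos
    refine ⟨by rw [sub_self]; positivity, ?_⟩
    have h1 : ‖gradH ψ B D lam gam vNew uNew‖ ^ 2 ≤ 0 := by
      nlinarith [sq_nonneg ‖uNew - u‖]
    nlinarith [norm_nonneg (gradH ψ B D lam gam vNew uNew)]

theorem norm_sub_convexCombination_sq {V : Type*} [NormedAddCommGroup V] [InnerProductSpace ℝ V]
    (α : ℝ) (x a b : V) : ‖x - ((1 - α) • a + α • b)‖ ^ 2 =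
      (1 - α) * ‖x - a‖ ^ 2 + α * ‖x - b‖ ^ 2 - α * (1 - α) * ‖a - b‖ ^ 2 := by
  have h1 : x - ((1 - α) • a + α • b) = (1 - α) • (x - a) + α • (x - b) := by module
  have h2 : a - b = (x - b) - (x - a) := by abel
  rw [h1, h2, norm_add_sq_real, norm_sub_sq_real (x - b) (x - a), norm_smul, norm_smul, real_inner_smul_left,
    real_inner_smul_right, mul_pow, mul_pow, Real.norm_eq_abs, Real.norm_eq_abs, sq_abs, sq_abs,
    real_inner_comm]
  ring

/-- The competitor is the old `u`. Splitting the square around the convex combination makes the `‖u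
- D v‖ ^ 2` correction common to both sides, so it cancels after scaling by `lam`. -/
theorem F_add_le_of_mem_uCandidates (hl : 0 < lam) (hg : 0 < gam) (hα0 : 0 < α)
    {u uNew : E n} {v : E m} (h : uNew ∈ uCandidates D gam α u v) :
    F ψ B D lam gam uNew v + lam * (1 - α) / (2 * α * gam) * ‖uNew - u‖ ^ 2 ≤
      F ψ B D lam gam u v := by
  have h1 := h u
  rw [norm_sub_convexCombination_sq, norm_sub_convexCombination_sq, sub_self, norm_zero] at h1
  have h2 := mul_le_mul_of_nonneg_left h1 hl.le
  have e1 : lam * (1 / (2 * (α * gam)) * ((1 - α) * ‖uNew - u‖ ^ 2 + α * ‖uNew - mulV D v‖ ^ 2 -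
      α * (1 - α) * ‖u - mulV D v‖ ^ 2) + l0norm uNew) =
      lam * (1 - α) / (2 * α * gam) * ‖uNew - u‖ ^ 2 + lam / (2 * gam) * ‖uNew - mulV D v‖ ^ 2
        - lam / (2 * gam) * (1 - α) * ‖u - mulV D v‖ ^ 2 + lam * l0norm uNew := by
    field_simp
  have e2 : lam * (1 / (2 * (α * gam)) * ((1 - α) * 0 ^ 2 + α * ‖u - mulV D v‖ ^ 2 -
      α * (1 - α) * ‖u - mulV D v‖ ^ 2) + l0norm u) =
      lam / (2 * gam) * ‖u - mulV D v‖ ^ 2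
        - lam / (2 * gam) * (1 - α) * ‖u - mulV D v‖ ^ 2 + lam * l0norm u := by
    field_simp
    ring
  rw [e1, e2] at h2
  unfold F
  linarith

theorem bddBelow_F (hb : BddBelow (Set.range ψ)) (hl : 0 < lam) (hg : 0 < gam) :
    ∃ b, ∀ (u : E n) (v : E m), b ≤ F ψ B D lam gam u v := by
  obtain ⟨b, hb⟩ := hb
  refine ⟨b, fun u v => ?_⟩
  have h1 : b ≤ ψ (mulV B v) := hb ⟨_, rfl⟩
  have h2 : 0 ≤ lam / (2 * gam) * ‖u - mulV D v‖ ^ 2 := by positivity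
  have h3 : 0 ≤ lam * l0norm u := mul_nonneg hl.le (Nat.cast_nonneg _)
  unfold F
  linarith

/-! ### Asymptotics of a run. -/

section Run

variable {e : ℕ → ℝ} {u : ℕ → E n} {v : ℕ → E m} {w : ℕ → E d}

theorem IsRun.tendsto_norm_sub (h : IsRun ψ B D lam gam α ρ p q e u v w)
    (hb : BddBelow (Set.range ψ)) (hl : 0 < lam) (hg : 0 < gam) (hα0 : 0 < α) (hρ0 : 0 < ρ)
    (hρ1 : ρ < lam / gam * ((1 - α) / α)) (he : ∀ k, 0 < e (k + 1)) :
    Tendsto (fun k => ‖u (k + 1) - u k‖) atTop (𝓝 0) := by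
  obtain ⟨b, hb⟩ := bddBelow_F (B := B) (D := D) hb hl hg
  set c := lam / gam * ((1 - α) / α) - ρ with hc
  have hc0 : 0 < c := sub_pos.2 hρ1
  have hstep : ∀ k, c / 2 * ‖u (k + 1) - u k‖ ^ 2 ≤
      F ψ B D lam gam (u k) (v k) - F ψ B D lam gam (u (k + 1)) (v (k + 1)) := fun k => by
    have h1 := F_add_le_of_mem_uCandidates (ψ := ψ) (B := B) hl hg hα0 (h k).1
    have h2 := ((h k).2.bounds (he k).le hρ0.le).1
    have h3 : c / 2 = lam * (1 - α) / (2 * α * gam) - ρ / 2 := by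
      rw [hc]; field_simp
    rw [h3, sub_mul]
    linarith
  have hsum : Summable fun k => c / 2 * ‖u (k + 1) - u k‖ ^ 2 := by
    refine summable_of_sum_range_le (fun k => by positivity) (fun N => ?_)
      (c := F ψ B D lam gam (u 0) (v 0) - b)
    have h1 := Finset.sum_le_sum fun k (_ : k ∈ Finset.range N) => hstep k
    rw [Finset.sum_range_sub'] at h1
    linarith [hb (u N) (v N)]
  have h1 := (hsum.tendsto_atTop_zero.const_mul (2 / c)).sqrt
  rw [mul_zero, Real.sqrt_zero] at h1
  refine h1.congr fun k => ?_
  rw [← mul_assoc, div_mul_div_cancel₀ hc0.ne', div_self two_ne_zero, one_mul,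
    Real.sqrt_sq (norm_nonneg _)]

/-- The index must be positive: `u 0` is arbitrary and not a thresholded vector. -/
theorem IsRun.le_sq_apply (h : IsRun ψ B D lam gam α ρ p q e u v w) (hg : 0 < gam) (hα0 : 0 < α)
    {k : ℕ} (hk : 1 ≤ k) {i : Fin n} (hi : i ∈ supp (u k)) : 2 * (α * gam) ≤ u k i ^ 2 := by
  obtain ⟨k, rfl⟩ := Nat.exists_eq_add_of_le' hk
  exact (apply_of_mem_prox_l0norm (mul_pos hα0 hg) (h k).1 (mem_supp.1 hi)).2

/-- An entry that enters or leaves the support moves by at least `√(2αγ)`, which vanishing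
increments eventually forbid. -/
theorem IsRun.exists_supp_eq (h : IsRun ψ B D lam gam α ρ p q e u v w) (hg : 0 < gam)
    (hα0 : 0 < α) (hlim : Tendsto (fun k => ‖u (k + 1) - u k‖) atTop (𝓝 0)) :
    ∃ (C : Finset (Fin n)) (K : ℕ), ∀ k, K ≤ k → supp (u k) = C := by
  have h1 : ∀ᶠ k in atTop, ‖u (k + 1) - u k‖ ^ 2 < 2 * (α * gam) := by
    have := hlim.pow 2
    rw [zero_pow two_ne_zero] at this
    exact this.eventually (gt_mem_nhds (by positivity))
  obtain ⟨K, hK⟩ := eventually_atTop.1 (h1.and (eventually_ge_atTop 1))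
  refine ⟨supp (u K), K, fun k hk => ?_⟩
  induction k, hk using Nat.le_induction with
  | base => rfl
  | succ k hk ih =>
    rw [← ih]
    obtain ⟨h2, h3⟩ := hK k hk
    have h4 : ∀ i, (u (k + 1) i - u k i) ^ 2 < 2 * (α * gam) := fun i => by
      refine lt_of_le_of_lt ?_ h2
      rw [EuclideanSpace.real_norm_sq_eq]
      exact Finset.single_le_sum (f := fun i => (u (k + 1) - u k) i ^ 2)
        (fun i _ => sq_nonneg _) (Finset.mem_univ i)
    ext i
    constructor
    · intro hi
      by_contra hi'
      have h5 := h.le_sq_apply hg hα0 (by lia) hi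
      rw [mem_supp, not_not] at hi'
      have h6 := h4 i
      rw [hi', sub_zero] at h6
      linarith
    · intro hi
      by_contra hi'
      have h5 := h.le_sq_apply hg hα0 h3 hi
      rw [mem_supp, not_not] at hi'
      have h6 := h4 i
      rw [hi', zero_sub, neg_sq] at h6
      linarith

theorem IsRun.eq_mulV_diagMask (h : IsRun ψ B D lam gam α ρ p q e u v w) (hg : 0 < gam)
    (hα0 : 0 < α) (k : ℕ) :
    u (k + 1) = mulV (diagMask (supp (u (k + 1)))) ((1 - α) • u k + α • mulV D (v k)) := by
  ext i
  rw [mulV_diagMask_apply]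
  split_ifs with hi
  · exact (apply_of_mem_prox_l0norm (mul_pos hα0 hg) (h k).1 (mem_supp.1 hi)).1
  · rwa [mem_supp, not_not] at hi

/-- The only error is `v (k + 1)` replacing the exact minimizer. The indices start at `1` because
the arbitrary `v 0` satisfies no accuracy bound. -/
theorem IsRun.norm_sub_T_le (h : IsRun ψ B D lam gam α ρ p q e u v w)
    (hψ : ConvexOn ℝ Set.univ ψ) (hd : Differentiable ℝ ψ)
    (hb : BddBelow (Set.range ψ)) (hl : 0 < lam) (hg : 0 < gam) (hD : Dᵀ * D = 1) (hα0 : 0 < α)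
    (hρ0 : 0 < ρ) (he : ∀ k, 0 < e (k + 1)) (k : ℕ) :
    ‖u (k + 2) - T ψ B D lam gam α (supp (u (k + 2))) (u (k + 1))‖ ≤
      α * (gam / lam * e (k + 1)) := by
  have h1 := h.eq_mulV_diagMask hg hα0 (k + 1)
  set C := supp (u (k + 2))
  have h2 : u (k + 2) - T ψ B D lam gam α C (u (k + 1)) = α • mulV (diagMask C) (mulV D
      (v (k + 1) - S ψ B lam gam (mulV Dᵀ (u (k + 1))))) := by
    rw [h1]
    simp only [T, mulV, map_sub, map_add, map_smul]
    module
  rw [h2, norm_smul, Real.norm_of_nonneg hα0.le]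
  refine mul_le_mul_of_nonneg_left ((norm_mulV_diagMask_le _ _).trans ?_) hα0.le
  rw [norm_mulV hD]
  refine (norm_sub_S_le hψ hd hb hl hg _ _).trans ?_
  exact mul_le_mul_of_nonneg_left ((h k).2.bounds (he k).le hρ0.le).2 (by positivity)

theorem IsRun.exists_tendsto_isLocalMin (h : IsRun ψ B D lam gam α ρ p q e u v w)
    (hψ : ConvexOn ℝ Set.univ ψ) (hd : Differentiable ℝ ψ)
    (hb : BddBelow (Set.range ψ)) (hl : 0 < lam) (hg : 0 < gam) (hD : Dᵀ * D = 1) (hα0 : 0 < α)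
    (hα1 : α < 1) (hρ0 : 0 < ρ) (he : ∀ k, 0 < e (k + 1)) (hsum : Summable fun k => e (k + 1))
    (hlim : Tendsto (fun k => ‖u (k + 1) - u k‖) atTop (𝓝 0)) {C : Finset (Fin n)} {K : ℕ}
    (hC : ∀ k, K ≤ k → supp (u k) = C) {x : E n}
    (hx : T ψ B D lam gam α C x = x) :
    ∃ uStar vStar, Tendsto (fun k => (u k, v k)) atTop (𝓝 (uStar, vStar)) ∧
      IsLocalMin (fun z : E n × E m => F ψ B D lam gam z.1 z.2) (uStar, vStar) := by
  have hT : LipschitzWith 1 (T ψ B D lam gam α C) := LipschitzWith.of_dist_le_mul fun x y => by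
    simpa [dist_eq_norm] using norm_T_sub_le hψ hd hb hl hg hD hα0.le hα1.le C x y
  have hreg : Tendsto (fun j => dist (u (j + 1 + K + 1)) (u (j + K + 1))) atTop (𝓝 0) := by
    simp only [dist_eq_norm]
    refine ((tendsto_add_atTop_iff_nat (K + 1)).2 hlim).congr fun j => ?_
    simp only [← add_assoc, add_right_comm j 1 K]
  obtain ⟨us, hus, hlim'⟩ := exists_tendsto_fixedPoint hT (x := fun j => u (j + K + 1))
    (((summable_nat_add_iff K).2 hsum).mul_left (gam / lam) |>.mul_left α) (fun j => by
      have h1 := h.norm_sub_T_le hψ hd hb hl hg hD hα0 hρ0 he (j + K)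
      rw [hC _ (by lia)] at h1
      rw [dist_eq_norm, add_right_comm j 1 K]
      exact h1) hreg hx
  have hu : Tendsto u atTop (𝓝 us) := (tendsto_add_atTop_iff_nat (K + 1)).1 hlim'
  set vs := S ψ B lam gam (mulV Dᵀ us) with hvs
  have hv : Tendsto v atTop (𝓝 vs) := by
    have hS : Continuous (S ψ B lam gam) :=
      (LipschitzWith.of_dist_le_mul (K := 1) fun x y => by
        simpa [dist_eq_norm] using norm_S_sub_le hψ hd hb hl hg x y).continuous
    have h1 : Tendsto (fun k => S ψ B lam gam (mulV Dᵀ (u (k + 1)))) atTop (𝓝 vs) :=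
      ((hS.comp (continuous_mulV Dᵀ)).tendsto us).comp ((tendsto_add_atTop_iff_nat 1).2 hu)
    have h2 : Tendsto (fun k => v (k + 1) - S ψ B lam gam (mulV Dᵀ (u (k + 1)))) atTop (𝓝 0) := by
      refine squeeze_zero_norm (fun k => (norm_sub_S_le hψ hd hb hl hg _ _).trans
        (mul_le_mul_of_nonneg_left ((h k).2.bounds (he k).le hρ0.le).2 (by positivity))) ?_
      simpa using hsum.tendsto_atTop_zero.const_mul (gam / lam)
    refine (tendsto_add_atTop_iff_nat 1).1 ?_
    simpa using h2.add h1
  refine ⟨us, vs, hu.prodMk_nhds hv,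
    isLocalMin_F hψ hd hl hg hD (gradH_S hd hb hl hg us) fun i hi => ?_⟩
  -- Off `C` the fixed-point equation reads `us i = 0`; on `C` it reduces, after cancelling `α`, to
  -- `us i = (D vs) i`.
  have hiC : i ∈ C := by
    by_contra hiC
    have h1 := congrArg (fun x : E n => x i) hus
    simp only [T, PiLp.add_apply, PiLp.smul_apply, mulV_diagMask_apply, if_neg hiC, smul_zero,
      add_zero] at h1
    exact mem_supp.1 hi h1.symm
  have h1 := congrArg (fun x : E n => x i) hus
  simp only [T, PiLp.add_apply, PiLp.smul_apply, mulV_diagMask_apply, if_pos hiC,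
    smul_eq_mul] at h1
  have h2 : α * mulV D vs i = α * us i := by rw [hvs]; linarith
  exact (mul_left_cancel₀ hα0.ne' h2).symm

end Run

end InexactFPPA

theorem mainTheorem1 {n m d : ℕ}
    (ψ : InexactFPPA.E d → ℝ) (hconv : ConvexOn ℝ Set.univ ψ) (hdiff : ContDiff ℝ 1 ψ)
    (hbdd : BddBelow (Set.range ψ))
    (B : Matrix (Fin d) (Fin m) ℝ) (D : Matrix (Fin n) (Fin m) ℝ) (hD : Dᵀ * D = 1)
    (lam gam α ρ p q : ℝ) (hlam : 0 < lam) (hgam : 0 < gam) (hα0 : 0 < α) (hα1 : α < 1)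
    (hρ0 : 0 < ρ) (hρ1 : ρ < lam / gam * ((1 - α) / α))
    (hp : 0 < p) (hq : 0 < q) (hpq : ‖B‖ ^ 2 < p * q)
    (e : ℕ → ℝ) (he : ∀ k : ℕ, 0 < e (k + 1)) (hsum : Summable fun k : ℕ => e (k + 1)) :
    -- every step of the algorithm can be carried out, and its inner loop terminates
    (∀ (k : ℕ) (u : InexactFPPA.E n) (v : InexactFPPA.E m) (w : InexactFPPA.E d),
      (InexactFPPA.uCandidates D gam α u v).Nonempty ∧
      ∀ uNew ∈ InexactFPPA.uCandidates D gam α u v,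
        ∃ (vNew : InexactFPPA.E m) (wNew : InexactFPPA.E d),
          InexactFPPA.InnerResult ψ B D lam gam ρ p q (e (k + 1)) u uNew v w vNew wNew) ∧
    -- every run has an eventually constant support `C`, and it converges to a local minimizer
    -- if the operator associated with `C` has a fixed point
    (∀ (u : ℕ → InexactFPPA.E n) (v : ℕ → InexactFPPA.E m) (w : ℕ → InexactFPPA.E d),
      InexactFPPA.IsRun ψ B D lam gam α ρ p q e u v w →
      ∃ C : Finset (Fin n), (∀ᶠ k in atTop, InexactFPPA.supp (u k) = C) ∧
        ((∃ x : InexactFPPA.E n, InexactFPPA.T ψ B D lam gam α C x = x) →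
          ∃ (uStar : InexactFPPA.E n) (vStar : InexactFPPA.E m),
            Tendsto (fun k => (u k, v k)) atTop (𝓝 (uStar, vStar)) ∧
            IsLocalMin (fun z : InexactFPPA.E n × InexactFPPA.E m =>
              InexactFPPA.F ψ B D lam gam z.1 z.2) (uStar, vStar))) := by
  refine ⟨fun k u v w => ⟨InexactFPPA.prox_l0norm_nonempty (mul_pos hα0 hgam) _, fun uNew _ =>
    InexactFPPA.exists_innerResult hconv hdiff hbdd hlam hgam hD hρ0 hp hq hpq.le (he k) u uNew v
      w⟩, fun u v w hrun => ?_⟩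
  have hlim := hrun.tendsto_norm_sub hbdd hlam hgam hα0 hρ0 hρ1 he
  obtain ⟨C, K, hC⟩ := hrun.exists_supp_eq hgam hα0 hlim
  exact ⟨C, eventually_atTop.2 ⟨K, hC⟩, fun ⟨x, hx⟩ =>
    hrun.exists_tendsto_isLocalMin hconv (hdiff.differentiable one_ne_zero) hbdd hlam hgam hD hα0
      hα1 hρ0 he hsum hlim hC hx⟩
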